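/- Let $d\le 2$, $N\in\mathbb N$, $m\in\mathbb R$ and let $$c(z,x,\tau)=c_0+\sum_{l=1}^N c_l(z,x)\,h_l(\tau)\qquad (z\ge 0,\ x\in\mathbb R^d,\ \tau\in\mathbb R)$$ satisfy the following (Assumption 1): (i) each $h_l:\mathbb R\to\mathbb R$ is a smooth symbol of order $m$, i.e. $|\partial_\tau^k h_l(\tau)|=O(|\tau|^{m-k})$ as $|\tau|\to\infty$ for all $k\in\mathbb N_0$, and there is $\eta_0>0$ such that $|h_l(\tau)|\ge\eta_0$ for $\tau$ near $0$ and all $l$; (ii) $c_0$ is a positive constant; (iii) there is $r\in(0,1)$ such that every $c_l$ is real-valued and belongs to $C^1([0,\infty),H^{r+1}(\mathbb R^d))$; (iv) $c(z,x,\tau)\ge c_0$ for all $z\ge 0$, $x\in\mathbb R^d$, $\tau\in\mathbb R$. Let $A(\tau;z)v=\operatorname{div}(c(z,\cdot,\tau)\nabla v)$, as an unbounded operator in $L^2(\mathbb R^d)$ with domain $H^2(\mathbb R^d)$. Let $Z>0$ and, for each $\tau\in\mathbb R$, let $(U(\tau;z_1,z_2))_{Z\ge z_1\ge z_2\ge 0}$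 be the evolution system on $L^2(\mathbb R^d)$ generated by $(iA(\tau;z))_{0\le z\le Z}$; that is, the $U(\tau;z_1,z_2)$ are bounded linear operators, strongly continuous in $(z_1,z_2)$, with $U(\tau;z,z)=I$ and $U(\tau;z_1,z_2)U(\tau;z_2,z_3)=U(\tau;z_1,z_3)$ for $Z\ge z_1\ge z_2\ge z_3\ge 0$, which map $H^2(\mathbb R^d)$ into itself, and for $v\in H^2(\mathbb R^d)$ the map $(z_1,z_2)\mapsto U(\tau;z_1,z_2)v\in L^2(\mathbb R^d)$ is continuously differentiable separately in each variable, with $$\partial_{z_1}U(\tau;z_1,z_2)v=iA(\tau;z_1)U(\tau;z_1,z_2)v,\qquad \partial_{z_2}U(\tau;z_1,z_2)v=-U(\tau;z_1,z_2)\,iA(\tau;z_2)v .$$ Then $(\tau,z_1,z_2)\mapsto U(\tau;z_1,z_2)$ is jointly strongly continuous from $\mathbb R\times\{(z_1,z_2): Z\ge z_1\ge z_2\ge 0\}$ into $L(L^2(\mathbb R^d))$, i.e. for every $v\in L^2(\mathbb R^d)$ the map $(\tau,z_1,z_2)\mapsto U(\tau;z_1,z_2)v\in L^2(\mathbb R^d)$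 is continuous on this set. -/

import Mathlib

open MeasureTheory Set Filter Topology Asymptotics
open scoped SchwartzMap LineDeriv ContDiff

noncomputable section

/-- `ℝ^d` with its Euclidean structure. -/
abbrev LateralSpace (d : ℕ) : Type := EuclideanSpace ℝ (Fin d)

/-- The complex Hilbert space `L²(ℝ^d)`. -/
abbrev LateralL2 (d : ℕ) : Type := Lp ℂ 2 (volume : Measure (LateralSpace d))

theorem LateralL2.coe_add {d : ℕ} (f g : LateralL2 d) :
    ((f + g : LateralL2 d) : 𝓢'(LateralSpace d, ℂ)) =
      (f : 𝓢'(LateralSpace d, ℂ)) + (g : 𝓢'(LateralSpace d, ℂ)) :=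
  map_add (Lp.toTemperedDistributionCLM ℂ volume 2) f g

theorem LateralL2.coe_smul {d : ℕ} (k : ℂ) (f : LateralL2 d) :
    ((k • f : LateralL2 d) : 𝓢'(LateralSpace d, ℂ)) = k • (f : 𝓢'(LateralSpace d, ℂ)) :=
  map_smul (Lp.toTemperedDistributionCLM ℂ volume 2) k f

theorem LateralL2.coe_zero {d : ℕ} :
    ((0 : LateralL2 d) : 𝓢'(LateralSpace d, ℂ)) = 0 :=
  map_zero (Lp.toTemperedDistributionCLM ℂ volume 2)

/-- The (real-valued) functions `u z`, `z ∈ S`, form a `C^1` map from `S ⊆ ℝ` into the Sobolev space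
`H^s(ℝ^d)`. The Bessel potential is an isometric isomorphism from `H^s` onto `L²`; so this means
that `z ↦ besselPotential s (u z)` is a `C^1` map with values in the Hilbert space `L²(ℝ^d)`. -/
def IsC1IntoSobolev {d : ℕ} (s : ℝ) (S : Set ℝ) (u : ℝ → LateralSpace d → ℝ) : Prop :=
  ∃ g : ℝ → LateralL2 d, ContDiffOn ℝ 1 g S ∧
    ∀ z ∈ S, ∃ f : LateralL2 d, (∀ᵐ x, f x = (u z x : ℂ)) ∧
      TemperedDistribution.besselPotential (LateralSpace d) ℂ s (f : 𝓢'(LateralSpace d, ℂ)) =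
        (g z : 𝓢'(LateralSpace d, ℂ))

/-- The coefficient `c(z,x,τ) = c₀ + ∑ l, c_l(z,x) h_l(τ)`. -/
def paraxialCoeff {d N : ℕ} (c₀ : ℝ) (c : Fin N → ℝ → LateralSpace d → ℝ) (h : Fin N → ℝ → ℝ)
    (z τ : ℝ) (x : LateralSpace d) : ℝ :=
  c₀ + ∑ l, c l z x * h l τ

/-- The standing assumption on the coefficient `c₀ + ∑ l, c_l(z,x) h_l(τ)`, where the `h_l` are
symbols of order `m`. -/
structure CoeffAssumption {d N : ℕ} (m c₀ : ℝ) (c : Fin N → ℝ → LateralSpace d → ℝ)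
    (h : Fin N → ℝ → ℝ) : Prop where
  smooth_symbol : ∀ l, ContDiff ℝ ∞ (h l)
  symbol_bound : ∀ l, ∀ k : ℕ,
    iteratedDeriv k (h l) =O[Bornology.cobounded ℝ] fun τ ↦ |τ| ^ (m - k)
  symbol_nonvanishing : ∃ η₀ > 0, ∀ l, ∀ᶠ τ in 𝓝 (0 : ℝ), η₀ ≤ |h l τ|
  const_pos : 0 < c₀
  regularity : ∃ r ∈ Ioo (0 : ℝ) 1, ∀ l, IsC1IntoSobolev (r + 1) (Ici 0) (c l)
  /-- As `c l z` represents a class in `H^{r+1}(ℝ^d)`, which has a continuous representative,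
  the lower bound for all `x` is a lower bound for almost all `x`. -/
  elliptic : ∀ z, 0 ≤ z → ∀ τ, ∀ᵐ x, c₀ ≤ paraxialCoeff c₀ c h z τ x

/-- The graph of `v ↦ div (a ∇v)` with domain in `H²(ℝ^d)`: the pairs `(v, w)` with `v ∈ H²`,
`w ∈ L²`, such that `w = ∑ j, ∂_j q_j` in the sense of distributions, where `q_j = a p_j ∈ L²` and
`p_j = ∂_j v ∈ L²`. -/
def divGradGraph {d : ℕ} (a : LateralSpace d → ℝ) : Submodule ℂ (LateralL2 d × LateralL2 d) where
  carrier := {y | TemperedDistribution.MemSobolev 2 2 (y.1 : 𝓢'(LateralSpace d, ℂ)) ∧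
    ∃ p q : Fin d → LateralL2 d,
      (∀ j, ∂_{EuclideanSpace.single j (1 : ℝ)} (y.1 : 𝓢'(LateralSpace d, ℂ)) =
        (p j : 𝓢'(LateralSpace d, ℂ))) ∧
      (∀ j, ∀ᵐ x, q j x = (a x : ℂ) * p j x) ∧
      (y.2 : 𝓢'(LateralSpace d, ℂ)) =
        ∑ j, ∂_{EuclideanSpace.single j (1 : ℝ)} (q j : 𝓢'(LateralSpace d, ℂ))}
  add_mem' := by
    rintro ⟨v, w⟩ ⟨v', w'⟩ ⟨hv, p, q, hp, hq, hw⟩ ⟨hv', p', q', hp', hq', hw'⟩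
    refine ⟨?_, p + p', q + q', fun j ↦ ?_, fun j ↦ ?_, ?_⟩
    · simpa only [Prod.mk_add_mk, LateralL2.coe_add] using hv.add hv'
    · simp only [Prod.mk_add_mk, Pi.add_apply, LateralL2.coe_add, LineDeriv.lineDerivOp_add]
      rw [hp j, hp' j]
    · filter_upwards [hq j, hq' j, Lp.coeFn_add (p j) (p' j), Lp.coeFn_add (q j) (q' j)]
        with x h1 h2 h3 h4
      simp only [Pi.add_apply] at *
      rw [h3, h4, h1, h2]; ring
    · simp only [Prod.mk_add_mk, Pi.add_apply, LateralL2.coe_add, LineDeriv.lineDerivOp_add,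
        Finset.sum_add_distrib]
      exact congrArg₂ _ hw hw'
  zero_mem' := by
    refine ⟨?_, 0, 0, fun j ↦ ?_, fun j ↦ ?_, ?_⟩
    · simp only [Prod.fst_zero, LateralL2.coe_zero]
      exact TemperedDistribution.memSobolev_fun_zero _ _ _ _
    · simp only [Prod.fst_zero, Pi.zero_apply, LateralL2.coe_zero, LineDeriv.lineDerivOp_zero]
    · filter_upwards [Lp.coeFn_zero ℂ 2 (volume : Measure (LateralSpace d))] with x hx
      simp only [Pi.zero_apply] at *
      rw [hx, mul_zero]
    · simp only [Prod.snd_zero, Pi.zero_apply, LateralL2.coe_zero, LineDeriv.lineDerivOp_zero,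
        Finset.sum_const_zero]
  smul_mem' := by
    rintro k ⟨v, w⟩ ⟨hv, p, q, hp, hq, hw⟩
    refine ⟨?_, k • p, k • q, fun j ↦ ?_, fun j ↦ ?_, ?_⟩
    · simpa only [Prod.smul_mk, LateralL2.coe_smul] using hv.smul k
    · simp only [Prod.smul_mk, Pi.smul_apply, LateralL2.coe_smul, LineDeriv.lineDerivOp_smul]
      rw [hp j]
    · filter_upwards [hq j, Lp.coeFn_smul k (p j), Lp.coeFn_smul k (q j)] with x h1 h3 h4
      simp only [Pi.smul_apply, smul_eq_mul] at *
      rw [h3, h4, h1]; ring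
    · simp only [Prod.smul_mk, Pi.smul_apply, LateralL2.coe_smul, LineDeriv.lineDerivOp_smul,
        ← Finset.smul_sum]
      exact congrArg _ hw

/-- The graph is single-valued. -/
theorem divGradGraph_single_valued {d : ℕ} (a : LateralSpace d → ℝ) (y : LateralL2 d × LateralL2 d)
    (hy : y ∈ divGradGraph a) (h0 : y.1 = 0) : y.2 = 0 := by
  obtain ⟨v, w⟩ := y
  obtain rfl : v = 0 := h0
  have inj : ∀ f : LateralL2 d, (f : 𝓢'(LateralSpace d, ℂ)) = 0 → f = 0 := by
    intro f hf
    have := Lp.ker_toTemperedDistributionCLM_eq_bot (E := LateralSpace d) (F := ℂ) (p := 2)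
      (μ := volume)
    exact LinearMap.ker_eq_bot'.1 this f hf
  rcases hy with ⟨-, p, q, hp, hq, hw⟩
  have hp0 : ∀ j, p j = 0 := by
    intro j
    apply inj
    rw [← hp j]
    simp only [LateralL2.coe_zero, LineDeriv.lineDerivOp_zero]
  have hq0 : ∀ j, q j = 0 := by
    intro j
    rw [Lp.eq_zero_iff_ae_eq_zero]
    have h1 := hp0 j
    rw [Lp.eq_zero_iff_ae_eq_zero] at h1
    filter_upwards [hq j, h1] with x h2 h3
    simp [h2, h3]
  apply inj
  refine hw.trans ?_
  refine Finset.sum_eq_zero fun j _ ↦ ?_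
  simp only [hq0 j, LateralL2.coe_zero, LineDeriv.lineDerivOp_zero]

/-- The unbounded operator `v ↦ div (a ∇v)` on `L²(ℝ^d)`: its domain consists of the `v ∈ H²(ℝ^d)`
with `div (a ∇v) ∈ L²(ℝ^d)`; this is all of `H²(ℝ^d)` for the coefficients under study. -/
def divGrad {d : ℕ} (a : LateralSpace d → ℝ) : LateralL2 d →ₗ.[ℂ] LateralL2 d :=
  (divGradGraph a).toLinearPMap

theorem divGrad_graph {d : ℕ} (a : LateralSpace d → ℝ) : (divGrad a).graph = divGradGraph a :=
  Submodule.toLinearPMap_graph_eq _ (divGradGraph_single_valued a)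

/-- `A(τ;z) v = div (c(z,·,τ) ∇v)`. -/
def paraxialOp {d N : ℕ} (c₀ : ℝ) (c : Fin N → ℝ → LateralSpace d → ℝ) (h : Fin N → ℝ → ℝ)
    (τ z : ℝ) : LateralL2 d →ₗ.[ℂ] LateralL2 d :=
  divGrad (paraxialCoeff c₀ c h z τ)

/-- The common domain of the operators `B z`, `0 ≤ z ≤ Z`. -/
def commonDomain {X : Type*} [NormedAddCommGroup X] [NormedSpace ℂ X] (Z : ℝ)
    (B : ℝ → X →ₗ.[ℂ] X) : Set X :=
  {v | ∀ z ∈ Icc 0 Z, v ∈ (B z).domain}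

/-- `U z₁ z₂`, `Z ≥ z₁ ≥ z₂ ≥ 0`, is an evolution system (fundamental solution) generated by the
family of unbounded operators `B z`, i.e. for the equation `∂_z v = B z v`. The values of `U` off
the triangle `Z ≥ z₁ ≥ z₂ ≥ 0` play no role. -/
structure IsEvolutionSystem {X : Type*} [NormedAddCommGroup X] [NormedSpace ℂ X] (Z : ℝ)
    (B : ℝ → X →ₗ.[ℂ] X) (U : ℝ → ℝ → X →L[ℂ] X) : Prop where
  stronglyContinuous : ∀ v,
    ContinuousOn (fun p : ℝ × ℝ ↦ U p.1 p.2 v) {p | Z ≥ p.1 ∧ p.1 ≥ p.2 ∧ p.2 ≥ 0}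
  refl : ∀ z ∈ Icc 0 Z, U z z = ContinuousLinearMap.id ℂ X
  comp : ∀ z₁ z₂ z₃, 0 ≤ z₃ → z₃ ≤ z₂ → z₂ ≤ z₁ → z₁ ≤ Z → (U z₁ z₂).comp (U z₂ z₃) = U z₁ z₃
  mapsTo : ∀ z₁ ∈ Icc 0 Z, ∀ z₂ ∈ Icc 0 z₁, ∀ v ∈ commonDomain Z B, U z₁ z₂ v ∈ commonDomain Z B
  contDiffOn_left : ∀ z₂ ∈ Icc 0 Z, ∀ v ∈ commonDomain Z B,
    ContDiffOn ℝ 1 (fun ζ ↦ U ζ z₂ v) (Icc z₂ Z)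
  hasDerivWithinAt_left : ∀ z₁ (h₁ : z₁ ∈ Icc 0 Z), ∀ z₂ (h₂ : z₂ ∈ Icc 0 z₁),
    ∀ v (hv : v ∈ commonDomain Z B),
      HasDerivWithinAt (fun ζ ↦ U ζ z₂ v) (B z₁ ⟨U z₁ z₂ v, mapsTo z₁ h₁ z₂ h₂ v hv z₁ h₁⟩)
        (Icc z₂ Z) z₁
  contDiffOn_right : ∀ z₁ ∈ Icc 0 Z, ∀ v ∈ commonDomain Z B,
    ContDiffOn ℝ 1 (fun ζ ↦ U z₁ ζ v) (Icc 0 z₁)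
  hasDerivWithinAt_right : ∀ z₁ ∈ Icc 0 Z, ∀ z₂ (h₂ : z₂ ∈ Icc 0 Z), z₂ ≤ z₁ →
    ∀ v (hv : v ∈ commonDomain Z B),
      HasDerivWithinAt (fun ζ ↦ U z₁ ζ v) (-(U z₁ z₂ (B z₂ ⟨v, hv z₂ h₂⟩))) (Icc 0 z₁) z₂

end

/-! Multiplication by a real coefficient is symmetric, so the flow preserves the L² norm on its
domain, and by density every U(τ; z₁, z₂) is a contraction. Hence it suffices to treat a dense set
of initial values; Schwartz functions serve, since they lie in the domain for all τ and z.
Continuity in (z₁, z₂) at a fixed τ₀ is part of the notion of evolution system, so what remains is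
U(τ; z₁, z₂)v → U(τ₀; z₁, z₂)v as τ → τ₀, uniformly in (z₁, z₂).

This comparison needs control of gradients only, not of second derivatives. If u and u' solve the
equations with coefficients a and a' and have the same initial value, then d/dζ ⟨u, u'⟩ = i⟨∇u, (a -
a')∇u'⟩. As both norms are conserved, ‖u - u'‖² = 2‖u(s)‖² - 2 Re⟨u, u'⟩ is controlled by sup ‖a -
a'‖ and the gradients (`IsFormSolution.norm_sub_sq_le`). The gradients are bounded by a Gronwall
argument for the energy ⟨∇u, a∇u⟩, which uses a ≥ c₀ and Lipschitz continuity of a in z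
(`IsFormSolution.grad_bound`).

The norms of a are those of multiplication operators, that is, L^∞ norms of the coefficient. They
are governed by the embedding of H^{r+1} into L^∞, valid because d ≤ 2 < 2(r+1)
(`CoeffAssumption.exists_vectorMul`). -/

noncomputable section

/-! ### Energy method for an abstract Schrödinger equation in weak form -/

section FormSolution

variable {X V : Type*} [NormedAddCommGroup X] [InnerProductSpace ℂ X]
  [NormedAddCommGroup V] [InnerProductSpace ℂ V]

/-- Here `G` is the graph of an abstract gradient. The function `u` solves `u' = i w` on `[s, t]`,
where `w = -∇* a ∇u` in the weak sense and `p = ∇u`. -/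
structure IsFormSolution (G : Submodule ℂ (X × V)) (a : ℝ → V →L[ℂ] V) (s t : ℝ) (u w : ℝ → X)
    (p : ℝ → V) : Prop where
  hasDerivWithinAt : ∀ ζ ∈ Icc s t, HasDerivWithinAt u (Complex.I • w ζ) (Icc s t) ζ
  continuousOn : ContinuousOn w (Icc s t)
  grad : ∀ ζ ∈ Icc s t, (u ζ, p ζ) ∈ G
  weak : ∀ ζ ∈ Icc s t, ∀ y ∈ G, inner ℂ y.1 (w ζ) = -inner ℂ y.2 (a ζ (p ζ))

namespace IsFormSolution

variable {G : Submodule ℂ (X × V)} {a a' : ℝ → V →L[ℂ] V} {s t : ℝ} {u u' w w' : ℝ → X}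
  {p p' : ℝ → V}

/-- Each equation is tested with the other solution; by symmetry of `a` only the difference of the
coefficients survives. With both solutions equal this is conservation of the norm. -/
theorem hasDerivWithinAt_inner (h : IsFormSolution G a s t u w p)
    (h' : IsFormSolution G a' s t u' w' p')
    (ha : ∀ ζ ∈ Icc s t, (a ζ : V →ₗ[ℂ] V).IsSymmetric) {ζ : ℝ} (hζ : ζ ∈ Icc s t) :
    HasDerivWithinAt (fun ζ ↦ inner ℂ (u ζ) (u' ζ))
      (Complex.I * inner ℂ (p ζ) ((a ζ - a' ζ) (p' ζ))) (Icc s t) ζ := by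
  have key := (h.hasDerivWithinAt ζ hζ).inner ℂ (h'.hasDerivWithinAt ζ hζ)
  refine key.congr_deriv ?_
  have e1 : inner ℂ (u ζ) (w' ζ) = -inner ℂ (p ζ) (a' ζ (p' ζ)) :=
    h'.weak ζ hζ _ (h.grad ζ hζ)
  have e2 : inner ℂ (w ζ) (u' ζ) = -inner ℂ (p ζ) (a ζ (p' ζ)) := by
    have e3 : inner ℂ (u' ζ) (w ζ) = -inner ℂ (p' ζ) (a ζ (p ζ)) :=
      h.weak ζ hζ _ (h'.grad ζ hζ)
    rw [← inner_conj_symm, e3, map_neg, inner_conj_symm]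
    exact congrArg _ (ha ζ hζ (p ζ) (p' ζ))
  rw [inner_smul_left, inner_smul_right, e1, e2, sub_apply, inner_sub_right,
    Complex.conj_I]
  ring

theorem norm_eq (h : IsFormSolution G a s t u w p)
    (ha : ∀ ζ ∈ Icc s t, (a ζ : V →ₗ[ℂ] V).IsSymmetric) {ζ : ℝ} (hζ : ζ ∈ Icc s t) :
    ‖u ζ‖ = ‖u s‖ := by
  have hd : ∀ x ∈ Icc s t, HasDerivWithinAt (fun ζ ↦ inner ℂ (u ζ) (u ζ)) 0 (Icc s t) x := by
    intro x hx
    simpa using h.hasDerivWithinAt_inner h ha hx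
  have hc := norm_image_sub_le_of_norm_deriv_le_segment' (C := 0) hd (by simp) ζ hζ
  rw [zero_mul, norm_le_zero_iff, sub_eq_zero, inner_self_eq_norm_sq_to_K,
    inner_self_eq_norm_sq_to_K] at hc
  have : ‖u ζ‖ ^ 2 = ‖u s‖ ^ 2 := by exact_mod_cast hc
  exact (sq_eq_sq₀ (norm_nonneg _) (norm_nonneg _)).1 this

/-- The energy estimate. -/
theorem grad_bound (h : IsFormSolution G a s t u w p)
    (ha : ∀ ζ ∈ Icc s t, (a ζ : V →ₗ[ℂ] V).IsSymmetric) {c₀ K : ℝ} (hc₀ : 0 < c₀) (hK : 0 ≤ K)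
    (hcoer : ∀ ζ ∈ Icc s t, ∀ q, c₀ * ‖q‖ ^ 2 ≤ (inner ℂ q (a ζ q)).re)
    (hlip : ∀ ζ ∈ Icc s t, ∀ ζ' ∈ Icc s t, ‖a ζ' - a ζ‖ ≤ K * |ζ' - ζ|) {ζ : ℝ}
    (hζ : ζ ∈ Icc s t) :
    c₀ * ‖p ζ‖ ^ 2 ≤ ‖a s‖ * ‖p s‖ ^ 2 * Real.exp (K / c₀ * (ζ - s)) := by
  set E : ℝ → ℝ := fun ζ ↦ (inner ℂ (p ζ) (a ζ (p ζ))).re with hE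
  have hEw : ∀ x ∈ Icc s t, E x = -(inner ℂ (u x) (w x)).re := by
    intro x hx
    rw [h.weak x hx _ (h.grad x hx)]
    simp [hE]
  have hucont : ContinuousOn u (Icc s t) := fun x hx ↦ (h.hasDerivWithinAt x hx).continuousWithinAt
  have hEcont : ContinuousOn E (Icc s t) := by
    refine ContinuousOn.congr ?_ hEw
    exact (Complex.continuous_re.comp_continuousOn (hucont.inner h.continuousOn)).neg
  have hpE : ∀ x ∈ Icc s t, c₀ * ‖p x‖ ^ 2 ≤ E x := fun x hx ↦ hcoer x hx _
  have hE0 : ∀ x ∈ Icc s t, 0 ≤ E x := fun x hx ↦ le_trans (by positivity) (hpE x hx)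
  have hpsq : ∀ x ∈ Icc s t, ‖p x‖ ≤ √(E x / c₀) := by
    intro x hx
    apply Real.le_sqrt_of_sq_le
    rw [le_div_iff₀ hc₀, mul_comm]
    exact hpE x hx
  -- The equations at `x` and at `y` are both tested with `u y - u x`; by symmetry the remainder is
  -- ⟨p x, (a y - a x) p y⟩, of order `y - x`. Gradients are replaced by `√(E / c₀)`, which is
  -- continuous, so that the limit y → x can be taken.
  have hincr : ∀ x ∈ Icc s t, ∀ y ∈ Icc s t, x < y → (y - x)⁻¹ * (E y - E x) ≤
      -(inner ℂ ((y - x)⁻¹ • (u y - u x)) (w y)).re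
      - (inner ℂ ((y - x)⁻¹ • (u y - u x)) (w x)).re + K * (√(E x / c₀) * √(E y / c₀)) := by
    intro x hx y hy hxy
    have hyx : 0 < y - x := sub_pos.2 hxy
    have hg : (u y - u x, p y - p x) ∈ G := G.sub_mem (h.grad y hy) (h.grad x hx)
    have e1 := h.weak y hy _ hg
    have e2 := h.weak x hx _ hg
    have e3 : (inner ℂ (p x) (a x (p y - p x))).re = (inner ℂ (p y - p x) (a x (p x))).re := by
      rw [← inner_conj_symm, Complex.conj_re]
      exact congrArg Complex.re (ha x hx _ _)
    have e4 : ‖inner ℂ (p x) ((a y - a x) (p y))‖ ≤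
        (y - x) * (K * (√(E x / c₀) * √(E y / c₀))) := by
      calc _ ≤ ‖p x‖ * (‖a y - a x‖ * ‖p y‖) :=
            (norm_inner_le_norm _ _).trans (by gcongr; exact (a y - a x).le_opNorm _)
        _ ≤ √(E x / c₀) * (K * |y - x| * √(E y / c₀)) := by
            gcongr
            · exact hpsq x hx
            · exact hlip x hx y hy
            · exact hpsq y hy
        _ = _ := by rw [abs_of_pos hyx]; ring
    have e5 := (Complex.re_le_norm _).trans e4
    have e6 : E y - E x = -(inner ℂ (u y - u x) (w y)).re - (inner ℂ (u y - u x) (w x)).re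
        + (inner ℂ (p x) ((a y - a x) (p y))).re := by
      simp only at e1 e2
      rw [e1, e2, Complex.neg_re, Complex.neg_re, neg_neg, sub_neg_eq_add, ← e3]
      simp only [hE, sub_apply, inner_sub_left, inner_sub_right,
        Complex.sub_re, map_sub]
      ring
    have e7 : ∀ v, (inner ℂ ((y - x)⁻¹ • (u y - u x)) v).re =
        (y - x)⁻¹ * (inner ℂ (u y - u x) v).re := by
      intro v
      rw [← Complex.coe_smul, inner_smul_left, Complex.conj_ofReal, Complex.re_ofReal_mul]
    rw [e7, e7, e6]
    have e8 : (y - x)⁻¹ * (inner ℂ (p x) ((a y - a x) (p y))).re ≤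
        K * (√(E x / c₀) * √(E y / c₀)) := by
      rw [inv_mul_le_iff₀ hyx]
      exact e5
    linarith
  -- Since `a` is only Lipschitz, `E` need not be differentiable, but a one-sided Dini bound
  -- suffices for Gronwall. In the limit the two terms with `w` become -2 Re⟨iw, w⟩ = 0.
  have hdini : ∀ x ∈ Ico s t, ∀ r, K / c₀ * E x < r →
      ∃ᶠ z in 𝓝[>] x, (z - x)⁻¹ * (E z - E x) < r := by
    intro x hx r hr
    have hx' : x ∈ Icc s t := Ico_subset_Icc_self hx
    have hmem : ∀ᶠ z in 𝓝[>] x, z ∈ Icc s t := by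
      filter_upwards [Ioc_mem_nhdsGT hx.2] with z hz
      exact ⟨hx.1.trans hz.1.le, hz.2⟩
    have hle : 𝓝[>] x ≤ 𝓝[Icc s t] x :=
      le_inf nhdsWithin_le_nhds (le_principal_iff.2 hmem)
    have hslope : Tendsto (fun z ↦ (z - x)⁻¹ • (u z - u x)) (𝓝[>] x)
        (𝓝 (Complex.I • w x)) := by
      have := (hasDerivWithinAt_iff_tendsto_slope.1 (h.hasDerivWithinAt x hx'))
      refine this.mono_left (le_inf nhdsWithin_le_nhds (le_principal_iff.2 ?_))
      filter_upwards [hmem, self_mem_nhdsWithin] with z hz hz'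
      exact ⟨hz, ne_of_gt hz'⟩
    have hw : Tendsto w (𝓝[>] x) (𝓝 (w x)) := (h.continuousOn x hx').tendsto.mono_left hle
    have hEt : Tendsto E (𝓝[>] x) (𝓝 (E x)) := (hEcont x hx').tendsto.mono_left hle
    have hlim : Tendsto (fun z ↦ -(inner ℂ ((z - x)⁻¹ • (u z - u x)) (w z)).re
        - (inner ℂ ((z - x)⁻¹ • (u z - u x)) (w x)).re + K * (√(E x / c₀) * √(E z / c₀))) (𝓝[>] x)
        (𝓝 (-(inner ℂ (Complex.I • w x) (w x)).re - (inner ℂ (Complex.I • w x) (w x)).re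
          + K * (√(E x / c₀) * √(E x / c₀)))) := by
      refine Tendsto.add (Tendsto.sub (Tendsto.neg ?_) ?_) ?_
      · exact (Complex.continuous_re.tendsto _).comp (hslope.inner hw)
      · exact (Complex.continuous_re.tendsto _).comp (hslope.inner tendsto_const_nhds)
      · exact ((hEt.div_const c₀).sqrt.const_mul _).const_mul _
    have hval : -(inner ℂ (Complex.I • w x) (w x)).re - (inner ℂ (Complex.I • w x) (w x)).re
          + K * (√(E x / c₀) * √(E x / c₀)) = K / c₀ * E x := by
      have : (inner ℂ (Complex.I • w x) (w x)).re = 0 := by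
        rw [inner_smul_left, inner_self_eq_norm_sq_to_K]
        simp [← Complex.ofReal_pow]
      rw [this, Real.mul_self_sqrt (div_nonneg (hE0 x hx') hc₀.le)]
      ring
    rw [hval] at hlim
    refine Eventually.frequently ?_
    filter_upwards [hlim.eventually (gt_mem_nhds hr), hmem, self_mem_nhdsWithin] with z h1 h2 h3
    exact (hincr x hx' z h2 h3).trans_lt h1
  have hs : s ∈ Icc s t := ⟨le_rfl, hζ.1.trans hζ.2⟩
  have hEs : E s ≤ ‖a s‖ * ‖p s‖ ^ 2 := by
    calc E s ≤ ‖inner ℂ (p s) (a s (p s))‖ := Complex.re_le_norm _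
      _ ≤ ‖p s‖ * (‖a s‖ * ‖p s‖) :=
        (norm_inner_le_norm _ _).trans (by gcongr; exact (a s).le_opNorm _)
      _ = _ := by ring
  have := le_gronwallBound_of_liminf_deriv_right_le (K := K / c₀) (ε := 0) hEcont hdini hEs
    (fun x _ ↦ by simp) ζ hζ
  rw [gronwallBound_ε0] at this
  exact (hpE ζ hζ).trans this

/-- Expand the square: the two norms stay equal to ‖u s‖, so the distance grows only through the
drift of Re⟨u, u'⟩ from its initial value ‖u s‖², whose speed is at most C²δ. -/
theorem norm_sub_sq_le (h : IsFormSolution G a s t u w p) (h' : IsFormSolution G a' s t u' w' p')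
    (ha : ∀ ζ ∈ Icc s t, (a ζ : V →ₗ[ℂ] V).IsSymmetric)
    (ha' : ∀ ζ ∈ Icc s t, (a' ζ : V →ₗ[ℂ] V).IsSymmetric) (h0 : u s = u' s) {C δ : ℝ}
    (hp : ∀ ζ ∈ Icc s t, ‖p ζ‖ ≤ C) (hp' : ∀ ζ ∈ Icc s t, ‖p' ζ‖ ≤ C)
    (hδ : ∀ ζ ∈ Icc s t, ‖a ζ - a' ζ‖ ≤ δ) {ζ : ℝ} (hζ : ζ ∈ Icc s t) :
    ‖u ζ - u' ζ‖ ^ 2 ≤ 2 * (C ^ 2 * δ) * (ζ - s) := by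
  have hs : s ∈ Icc s t := ⟨le_rfl, hζ.1.trans hζ.2⟩
  have hC : 0 ≤ C := (norm_nonneg _).trans (hp s hs)
  have hd := fun x hx ↦ h.hasDerivWithinAt_inner h' ha (ζ := x) hx
  have hb : ∀ x ∈ Ico s t, ‖Complex.I * inner ℂ (p x) ((a x - a' x) (p' x))‖ ≤ C ^ 2 * δ := by
    intro x hx
    have hx' := Ico_subset_Icc_self hx
    rw [norm_mul, Complex.norm_I, one_mul]
    calc _ ≤ ‖p x‖ * (‖a x - a' x‖ * ‖p' x‖) :=
          (norm_inner_le_norm _ _).trans (by gcongr; exact (a x - a' x).le_opNorm _)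
      _ ≤ C * (δ * C) := by
          have hδ0 : 0 ≤ δ := (norm_nonneg _).trans (hδ x hx')
          gcongr
          exacts [hp x hx', hδ x hx', hp' x hx']
      _ = _ := by ring
  have key := norm_image_sub_le_of_norm_deriv_le_segment' hd hb ζ hζ
  have k2 := (abs_le.1 ((Complex.abs_re_le_norm _).trans key)).1
  rw [Complex.sub_re, ← h0, inner_self_eq_norm_sq_to_K] at k2
  have k3 : (((‖u s‖ : ℝ) : ℂ) ^ 2).re = ‖u s‖ ^ 2 := by
    rw [← Complex.ofReal_pow, Complex.ofReal_re]
  have k4 := norm_sub_sq (𝕜 := ℂ) (u ζ) (u' ζ)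
  rw [h.norm_eq ha hζ, h'.norm_eq ha' hζ, ← h0] at k4
  change (-(C ^ 2 * δ * (ζ - s)) ≤ (inner ℂ (u ζ) (u' ζ)).re - (((‖u s‖ : ℝ) : ℂ) ^ 2).re) at k2
  change _ = _ - 2 * (inner ℂ (u ζ) (u' ζ)).re + _ at k4
  rw [k3] at k2
  rw [k4]
  linarith

end IsFormSolution

end FormSolution

/-! ### Plancherel, integration by parts and Sobolev embedding -/

section FourierSobolev

open FourierTransform TemperedDistribution

variable {d : ℕ}

theorem ae_eq_of_forall_integral_schwartz_smul_eq {f g : LateralSpace d → ℂ}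
    (hf : LocallyIntegrable f) (hg : LocallyIntegrable g)
    (h : ∀ ψ : 𝓢(LateralSpace d, ℂ), ∫ x, ψ x • f x = ∫ x, ψ x • g x) : f =ᵐ[volume] g := by
  refine ae_eq_of_integral_contDiff_smul_eq hf hg fun φ hφ hc ↦ ?_
  have hg₁ : HasCompactSupport (Complex.ofRealCLM ∘ φ) := hc.comp_left rfl
  have hg₂ : ContDiff ℝ ∞ (Complex.ofRealCLM ∘ φ) := by fun_prop
  simpa using h (hg₁.toSchwartzMap hg₂)

theorem LateralL2.locallyIntegrable (f : LateralL2 d) : LocallyIntegrable f :=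
  (Lp.memLp f).locallyIntegrable (by norm_num)

/-- Pairing with a Schwartz function moves the multipliers onto it. The sum is treated as a whole
because the single products `g i * f i` need not be square integrable; they are only locally
integrable. -/
theorem LateralL2.ae_eq_of_sum_smulLeftCLM_eq {ι : Type*} [Fintype ι]
    {g : ι → LateralSpace d → ℂ} (hg : ∀ i, (g i).HasTemperateGrowth) (f : ι → LateralL2 d)
    (w : LateralL2 d)
    (h : ∑ i, smulLeftCLM ℂ (g i) (f i : 𝓢'(LateralSpace d, ℂ)) = (w : 𝓢'(LateralSpace d, ℂ))) :
    ∀ᵐ x, w x = ∑ i, g i x * f i x := by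
  have hloc : ∀ i, LocallyIntegrable fun x ↦ g i x * f i x := fun i ↦ by
    rw [← locallyIntegrableOn_univ]
    exact ((LateralL2.locallyIntegrable (f i)).locallyIntegrableOn univ).continuousOn_smul
      isOpen_univ.isLocallyClosed (hg i).1.continuous.continuousOn
  refine ae_eq_of_forall_integral_schwartz_smul_eq (LateralL2.locallyIntegrable w)
    (locallyIntegrable_finsetSum _ fun i _ ↦ hloc i) fun ψ ↦ ?_
  have h1 := congrArg (fun T : 𝓢'(LateralSpace d, ℂ) ↦ T ψ) h
  have h2 : ∀ i, Integrable fun x ↦ ψ x • (g i x * f i x) := fun i ↦ by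
    have : Integrable fun x ↦ (SchwartzMap.smulLeftCLM ℂ (g i) ψ) x * f i x :=
      ((SchwartzMap.smulLeftCLM ℂ (g i) ψ).memLp 2 volume).integrable_mul (Lp.memLp (f i))
    refine this.congr (ae_of_all _ fun x ↦ ?_)
    simp only [SchwartzMap.smulLeftCLM_apply_apply (hg i), smul_eq_mul]
    ring
  simp only [Lp.toTemperedDistribution_apply] at h1
  rw [← h1]
  simp_rw [Finset.smul_sum]
  rw [integral_finsetSum _ fun i _ ↦ h2 i]
  rw [sum_apply]
  refine Finset.sum_congr rfl fun i _ ↦ ?_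
  rw [smulLeftCLM_apply_apply, Lp.toTemperedDistribution_apply]
  refine integral_congr_ae (ae_of_all _ fun x ↦ ?_)
  simp only [SchwartzMap.smulLeftCLM_apply_apply (hg i), smul_eq_mul]
  ring

/-- The symbol of the `j`-th partial derivative. -/
def partialSymbol (j : Fin d) (ξ : LateralSpace d) : ℂ :=
  (2 * Real.pi * Complex.I) * (inner ℝ ξ (EuclideanSpace.single j (1 : ℝ)) : ℝ)

theorem partialSymbol_hasTemperateGrowth (j : Fin d) :
    (partialSymbol j).HasTemperateGrowth := by
  unfold partialSymbol
  fun_prop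

theorem conj_partialSymbol (j : Fin d) (ξ : LateralSpace d) :
    (starRingEnd ℂ) (partialSymbol j ξ) = -partialSymbol j ξ := by
  simp [partialSymbol, Complex.conj_ofNat]

theorem fourier_lineDerivOp_eq_smulLeftCLM (j : Fin d) (T : 𝓢'(LateralSpace d, ℂ)) :
    𝓕 (∂_{EuclideanSpace.single j (1 : ℝ)} T) = smulLeftCLM ℂ (partialSymbol j) (𝓕 T) := by
  rw [TemperedDistribution.fourier_lineDerivOp_eq]
  have h : partialSymbol j = (2 * Real.pi * Complex.I) •
      fun ξ : LateralSpace d ↦ ((inner ℝ ξ (EuclideanSpace.single j (1 : ℝ)) : ℝ) : ℂ) := rfl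
  rw [h, smulLeftCLM_smul (by fun_prop)]
  rfl

/-- Integration by parts for the divergence of square integrable vector fields. -/
theorem LateralL2.inner_eq_neg_sum_inner {φ w : LateralL2 d} {r q : Fin d → LateralL2 d}
    (hr : ∀ j, ∂_{EuclideanSpace.single j (1 : ℝ)} (φ : 𝓢'(LateralSpace d, ℂ)) =
      (r j : 𝓢'(LateralSpace d, ℂ)))
    (hw : (w : 𝓢'(LateralSpace d, ℂ)) =
      ∑ j, ∂_{EuclideanSpace.single j (1 : ℝ)} (q j : 𝓢'(LateralSpace d, ℂ))) :
    inner ℂ φ w = -∑ j, inner ℂ (r j) (q j) := by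
  have hr' : ∀ j, ∀ᵐ ξ, (𝓕 (r j) : LateralL2 d) ξ = partialSymbol j ξ * (𝓕 φ : LateralL2 d) ξ := by
    intro j
    have := LateralL2.ae_eq_of_sum_smulLeftCLM_eq (ι := Unit) (g := fun _ ↦ partialSymbol j)
      (fun _ ↦ partialSymbol_hasTemperateGrowth j) (fun _ ↦ 𝓕 φ) (𝓕 (r j)) (by
        rw [← Lp.fourier_toTemperedDistribution_eq, ← Lp.fourier_toTemperedDistribution_eq, ← hr j,
          fourier_lineDerivOp_eq_smulLeftCLM]
        simp)
    simpa using this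
  have hw' : ∀ᵐ ξ, (𝓕 w : LateralL2 d) ξ =
      ∑ j, partialSymbol j ξ * (𝓕 (q j) : LateralL2 d) ξ := by
    refine LateralL2.ae_eq_of_sum_smulLeftCLM_eq partialSymbol_hasTemperateGrowth
      (fun j ↦ 𝓕 (q j)) (𝓕 w) ?_
    simp_rw [← Lp.fourier_toTemperedDistribution_eq, ← fourier_lineDerivOp_eq_smulLeftCLM]
    rw [hw]
    exact (map_sum (FourierTransform.fourierCLM ℂ 𝓢'(LateralSpace d, ℂ)) _ _).symm
  -- After Plancherel the identity holds pointwise under the integral: the symbol of a partial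
  -- derivative is purely imaginary, so moving it to the other factor changes the sign.
  rw [← Lp.inner_fourier_eq]
  simp_rw [← Lp.inner_fourier_eq (r _)]
  simp_rw [L2.inner_def]
  rw [← integral_finsetSum _ fun j _ ↦ L2.integrable_inner _ _, ← integral_neg]
  refine integral_congr_ae ?_
  filter_upwards [hw', ae_all_iff.2 hr'] with ξ h1 h2
  rw [h1, inner_sum, ← Finset.sum_neg_distrib]
  refine Finset.sum_congr rfl fun j _ ↦ ?_
  rw [h2 j]
  simp only [RCLike.inner_apply, map_mul, conj_partialSymbol]
  ring

theorem memLp_two_one_add_norm_sq_rpow {s : ℝ} (hs : (d : ℝ) < 2 * s) :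
    MemLp (fun x : LateralSpace d ↦ Complex.ofReal ((1 + ‖x‖ ^ 2) ^ (-s / 2) : ℝ)) 2 := by
  have hc : Continuous fun x : LateralSpace d ↦ ((1 + ‖x‖ ^ 2) ^ (-s / 2) : ℝ) :=
    Continuous.rpow_const (by fun_prop) fun x ↦ Or.inl (by positivity)
  refine MemLp.ofReal ((memLp_two_iff_integrable_sq hc.aestronglyMeasurable).2 ?_)
  have := integrable_rpow_neg_one_add_norm_sq (E := LateralSpace d) (μ := volume) (r := 2 * s)
    (by simpa using hs)
  refine this.congr (ae_of_all _ fun x ↦ ?_)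
  simp only
  rw [← Real.rpow_mul_natCast (by positivity)]
  congr 1
  push_cast
  ring

/-- The Sobolev embedding `H^s ⊆ L^∞` for `s > d / 2`. -/
theorem exists_ae_norm_le_of_besselPotential {s : ℝ} (hs : (d : ℝ) < 2 * s) :
    ∃ C : ℝ, 0 ≤ C ∧ ∀ f g : LateralL2 d,
      besselPotential (LateralSpace d) ℂ s (f : 𝓢'(LateralSpace d, ℂ)) =
        (g : 𝓢'(LateralSpace d, ℂ)) → ∀ᵐ x, ‖f x‖ ≤ C * ‖g‖ := by
  have hJ := memLp_two_one_add_norm_sq_rpow hs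
  refine ⟨‖hJ.toLp‖, norm_nonneg _, fun f g hfg ↦ ?_⟩
  -- The Fourier transform of `g` times the weight (1 + ‖ξ‖²)^(-s/2): a product of two L² functions,
  -- hence in L¹. It is the Fourier transform of `f`, so ‖W‖ bounds `f`.
  set W : Lp ℂ 1 (volume : Measure (LateralSpace d)) := hJ.toLp • (𝓕 g : LateralL2 d) with hW
  have hWf : 𝓕 (f : 𝓢'(LateralSpace d, ℂ)) = (W : 𝓢'(LateralSpace d, ℂ)) := by
    rw [hW, Lp.toTemperedDistribution_smul_eq (by fun_prop),
      ← Lp.fourier_toTemperedDistribution_eq, ← hfg,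
      fourier_besselPotential_eq_smulLeftCLM_fourier_apply,
      smulLeftCLM_smulLeftCLM_apply (by fun_prop) (by fun_prop)]
    convert (smulLeftCLM_const (1 : ℂ) (𝓕 (f : 𝓢'(LateralSpace d, ℂ)))).symm using 1
    · simp
    · congr 1
      congr 1
      ext x
      rw [Pi.mul_apply]
      norm_cast
      rw [← Real.rpow_add (by positivity)]
      ring_nf
      simp
  have hWint : Integrable W := L1.integrable_coeFn W
  have hcont : Continuous (𝓕⁻ (W : LateralSpace d → ℂ)) :=
    VectorFourier.fourierIntegral_continuous Real.continuous_fourierChar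
      (by exact continuous_inner.neg) hWint
  have hfW : f =ᵐ[volume] 𝓕⁻ (W : LateralSpace d → ℂ) := by
    refine ae_eq_of_forall_integral_schwartz_smul_eq (LateralL2.locallyIntegrable f)
      hcont.locallyIntegrable fun ψ ↦ ?_
    calc ∫ x, ψ x • f x = (f : 𝓢'(LateralSpace d, ℂ)) ψ := (Lp.toTemperedDistribution_apply _ _).symm
      _ = 𝓕 (f : 𝓢'(LateralSpace d, ℂ)) (𝓕⁻ ψ) := by simp
      _ = ∫ x, (𝓕⁻ ψ) x • W x := by rw [hWf, Lp.toTemperedDistribution_apply]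
      _ = ∫ x, ψ x • 𝓕⁻ (W : LateralSpace d → ℂ) x := by
        rw [SchwartzMap.fourierInv_coe]
        have := VectorFourier.integral_fourierIntegral_smul_eq_flip (μ := volume) (ν := volume)
          (L := -innerₗ (LateralSpace d)) Real.continuous_fourierChar
          (by exact continuous_inner.neg) (SchwartzMap.integrable ψ) hWint
        have hflip : (-innerₗ (LateralSpace d)).flip = -innerₗ (LateralSpace d) := by
          ext x y
          simp [real_inner_comm]
        rw [hflip] at this
        exact this
  have hnorm : ‖W‖ ≤ ‖hJ.toLp‖ * ‖g‖ := by
    have := Lp.norm_smul_le (r := 1) hJ.toLp (𝓕 g : LateralL2 d)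
    rwa [Lp.norm_fourier_eq] at this
  filter_upwards [hfW] with x hx
  rw [hx]
  calc _ ≤ ∫ ξ, ‖W ξ‖ := VectorFourier.norm_fourierIntegral_le_integral_norm _ _ _ _ _
    _ = ‖W‖ := (L1.norm_eq_integral_norm W).symm
    _ ≤ _ := hnorm

end FourierSobolev

/-! ### Coefficients as multiplication operators on vector fields -/

section Coefficients

open FourierTransform TemperedDistribution

variable {d : ℕ}

theorem Lp_top_norm_le_of_ae_bound {f : Lp ℂ ⊤ (volume : Measure (LateralSpace d))} {C : ℝ}
    (hC : 0 ≤ C) (h : ∀ᵐ x, ‖f x‖ ≤ C) : ‖f‖ ≤ C := by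
  rw [Lp.norm_def, eLpNorm_exponent_top]
  exact ENNReal.toReal_le_of_le_ofReal hC (eLpNormEssSup_le_of_ae_bound h)

theorem ContDiffOn.exists_forall_Icc_norm_sub_le {E : Type*} [NormedAddCommGroup E]
    [NormedSpace ℝ E] {g : ℝ → E} (hg : ContDiffOn ℝ 1 g (Ici 0)) (Z : ℝ) :
    ∃ K : ℝ, 0 ≤ K ∧ ∀ z ∈ Icc 0 Z, ∀ z' ∈ Icc 0 Z, ‖g z' - g z‖ ≤ K * |z' - z| := by
  have hc : ContinuousOn (derivWithin g (Ici 0)) (Icc 0 Z) :=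
    (hg.continuousOn_derivWithin (uniqueDiffOn_Ici 0) le_rfl).mono Icc_subset_Ici_self
  obtain ⟨K, hK⟩ := isCompact_Icc.exists_bound_of_continuousOn hc
  refine ⟨max K 0, le_max_right _ _, fun z hz z' hz' ↦ ?_⟩
  have hd : ∀ x ∈ Icc 0 Z, HasDerivWithinAt g (derivWithin g (Ici 0) x) (Icc 0 Z) x := fun x hx ↦
    ((hg.differentiableOn one_ne_zero x hx.1).hasDerivWithinAt).mono Icc_subset_Ici_self
  exact (convex_Icc 0 Z).norm_image_sub_le_of_norm_hasDerivWithin_le hd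
    (fun x hx ↦ (hK x hx).trans (le_max_left _ _)) hz hz'

/-- A `C^1` family in `H^s(ℝ^d)`, `s > d / 2`, is a Lipschitz continuous family in `L^∞`. -/
theorem IsC1IntoSobolev.exists_Lp_top {s : ℝ} (hs : (d : ℝ) < 2 * s)
    {c : ℝ → LateralSpace d → ℝ} (hc : IsC1IntoSobolev s (Ici 0) c) (Z : ℝ) :
    ∃ (C : ℝ → Lp ℂ ⊤ (volume : Measure (LateralSpace d))) (K : ℝ), 0 ≤ K ∧
      (∀ z ∈ Icc 0 Z, ∀ᵐ x, C z x = c z x) ∧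
      ∀ z ∈ Icc 0 Z, ∀ z' ∈ Icc 0 Z, ‖C z' - C z‖ ≤ K * |z' - z| := by
  obtain ⟨g, hg, hf⟩ := hc
  obtain ⟨M, hM, hbound⟩ := exists_ae_norm_le_of_besselPotential hs
  obtain ⟨K, hK, hlip⟩ := hg.exists_forall_Icc_norm_sub_le Z
  choose! f hfc hfg using hf
  have hmem : ∀ z ∈ Ici (0 : ℝ), MemLp (f z) ⊤ := fun z hz ↦
    memLp_top_of_bound (Lp.aestronglyMeasurable _) _ (hbound _ _ (hfg z hz))
  classical
  refine ⟨fun z ↦ if hz : z ∈ Ici (0 : ℝ) then (hmem z hz).toLp else 0, M * K, by positivity,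
    fun z hz ↦ ?_, fun z hz z' hz' ↦ ?_⟩
  · have hz0 : z ∈ Ici (0 : ℝ) := hz.1
    simp only [dif_pos hz0]
    filter_upwards [(hmem z hz0).coeFn_toLp, hfc z hz0] with x h1 h2
    rw [h1, h2]
  · have hz0 : z ∈ Ici (0 : ℝ) := hz.1
    have hz0' : z' ∈ Ici (0 : ℝ) := hz'.1
    simp only [dif_pos hz0, dif_pos hz0']
    -- The Bessel potential is linear, so the embedding applies to differences and carries the
    -- Lipschitz bound from `g` over to L^∞.
    have hsub : besselPotential (LateralSpace d) ℂ s
        ((f z' - f z : LateralL2 d) : 𝓢'(LateralSpace d, ℂ)) =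
        ((g z' - g z : LateralL2 d) : 𝓢'(LateralSpace d, ℂ)) := by
      have e : ∀ u v : LateralL2 d, ((u - v : LateralL2 d) : 𝓢'(LateralSpace d, ℂ)) =
          (u : 𝓢'(LateralSpace d, ℂ)) - (v : 𝓢'(LateralSpace d, ℂ)) :=
        map_sub (Lp.toTemperedDistributionCLM ℂ volume 2)
      rw [e, e, map_sub, hfg z hz0, hfg z' hz0']
    refine Lp_top_norm_le_of_ae_bound (by positivity) ?_
    filter_upwards [hbound _ _ hsub, Lp.coeFn_sub (f z') (f z), (hmem z hz0).coeFn_toLp,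
      (hmem z' hz0').coeFn_toLp, Lp.coeFn_sub (hmem z' hz0').toLp (hmem z hz0).toLp]
      with x h1 h2 h3 h4 h5
    rw [h2, Pi.sub_apply] at h1
    rw [h5, Pi.sub_apply, h3, h4, mul_assoc]
    exact h1.trans (by gcongr; exact hlip z hz z' hz')

/-- Square integrable vector fields. -/
abbrev LateralVector (d : ℕ) : Type := PiLp 2 fun _ : Fin d ↦ LateralL2 d

/-- Multiplication of vector fields by a bounded function. -/
def vectorMul (C : Lp ℂ ⊤ (volume : Measure (LateralSpace d))) :
    LateralVector d →L[ℂ] LateralVector d :=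
  LinearMap.mkContinuous
    { toFun := fun p ↦ WithLp.toLp 2 fun j ↦ (C • (p j : LateralL2 d) : LateralL2 d)
      map_add' := fun p q ↦ by
        ext1 j
        exact Lp.add_smul C (p j : LateralL2 d) (q j : LateralL2 d)
      map_smul' := fun k p ↦ by
        ext1 j
        exact (Lp.smul_comm k C (p j : LateralL2 d)).symm } ‖C‖ fun p ↦ by
    rw [← sq_le_sq₀ (norm_nonneg _) (by positivity), mul_pow, PiLp.norm_sq_eq_of_L2,
      PiLp.norm_sq_eq_of_L2, Finset.mul_sum]
    refine Finset.sum_le_sum fun j _ ↦ ?_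
    rw [← mul_pow]
    exact pow_le_pow_left₀ (norm_nonneg _) (Lp.norm_smul_le C (p j : LateralL2 d)) 2

theorem vectorMul_apply (C : Lp ℂ ⊤ (volume : Measure (LateralSpace d))) (p : LateralVector d)
    (j : Fin d) : vectorMul C p j = (C • (p j : LateralL2 d) : LateralL2 d) := rfl

theorem norm_vectorMul_le (C : Lp ℂ ⊤ (volume : Measure (LateralSpace d))) :
    ‖vectorMul C‖ ≤ ‖C‖ :=
  LinearMap.mkContinuous_norm_le _ (norm_nonneg _) _

theorem vectorMul_sub (C C' : Lp ℂ ⊤ (volume : Measure (LateralSpace d))) :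
    vectorMul (C - C') = vectorMul C - vectorMul C' := by
  ext1 p
  ext1 j
  rw [sub_apply, PiLp.sub_apply, vectorMul_apply, vectorMul_apply, vectorMul_apply]
  have h := Lp.smul_add (r := 2) C (-C') (p j : LateralL2 d)
  rw [Lp.neg_smul, ← sub_eq_add_neg, ← sub_eq_add_neg] at h
  exact h

/-- `A` is the multiplication of vector fields by the real-valued function `α`. -/
def IsVectorMul (A : LateralVector d →L[ℂ] LateralVector d) (α : LateralSpace d → ℝ) : Prop :=
  ∀ p j, ∀ᵐ x, A p j x = (α x : ℂ) * p j x

namespace IsVectorMul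

variable {A : LateralVector d →L[ℂ] LateralVector d} {α : LateralSpace d → ℝ}

theorem isSymmetric (h : IsVectorMul A α) :
    (A : LateralVector d →ₗ[ℂ] LateralVector d).IsSymmetric := by
  intro p q
  simp only [ContinuousLinearMap.coe_coe, PiLp.inner_apply, L2.inner_def]
  refine Finset.sum_congr rfl fun j _ ↦ integral_congr_ae ?_
  filter_upwards [h p j, h q j] with x h1 h2
  rw [h1, h2]
  simp only [RCLike.inner_apply, map_mul, Complex.conj_ofReal]
  ring

theorem mul_norm_sq_le (h : IsVectorMul A α) {c₀ : ℝ} (hα : ∀ᵐ x, c₀ ≤ α x)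
    (p : LateralVector d) : c₀ * ‖p‖ ^ 2 ≤ (inner ℂ p (A p)).re := by
  rw [PiLp.norm_sq_eq_of_L2, PiLp.inner_apply, Finset.mul_sum, Complex.re_sum]
  refine Finset.sum_le_sum fun j _ ↦ ?_
  have e : ‖p j‖ ^ 2 = (inner ℂ (p j) (p j)).re := (inner_self_eq_norm_sq (𝕜 := ℂ) (p j)).symm
  rw [e, L2.inner_def, L2.inner_def]
  have e1 : (∫ x, inner ℂ (p j x) (p j x)).re = ∫ x, (inner ℂ (p j x) (p j x)).re :=
    (integral_re (𝕜 := ℂ) (L2.integrable_inner (𝕜 := ℂ) (p j) (p j))).symm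
  have e2 : (∫ x, inner ℂ (p j x) (A p j x)).re = ∫ x, (inner ℂ (p j x) (A p j x)).re :=
    (integral_re (𝕜 := ℂ) (L2.integrable_inner (𝕜 := ℂ) (p j) (A p j))).symm
  rw [e1, e2, ← integral_const_mul]
  refine integral_mono_ae ((L2.integrable_inner (𝕜 := ℂ) (p j) (p j)).re.const_mul c₀)
    (L2.integrable_inner (𝕜 := ℂ) (p j) (A p j)).re ?_
  filter_upwards [hα, h p j] with x h1 h2
  rw [h2]
  have e3 : (inner ℂ (p j x) ((α x : ℂ) * p j x)).re = α x * (inner ℂ (p j x) (p j x)).re := by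
    rw [← smul_eq_mul, inner_smul_right, Complex.re_ofReal_mul]
  change c₀ * (inner ℂ (p j x) (p j x)).re ≤ (inner ℂ (p j x) ((α x : ℂ) * p j x)).re
  rw [e3]
  exact mul_le_mul_of_nonneg_right h1 (inner_self_nonneg (𝕜 := ℂ) (x := p j x))

end IsVectorMul

/-- Multiplication of vector fields by `c₀ + ∑ l, C l * k l`. -/
def coeffMul {N : ℕ} (c₀ : ℝ) (C : Fin N → Lp ℂ ⊤ (volume : Measure (LateralSpace d)))
    (k : Fin N → ℝ) : LateralVector d →L[ℂ] LateralVector d :=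
  (c₀ : ℂ) • ContinuousLinearMap.id ℂ _ + ∑ l, (k l : ℂ) • vectorMul (C l)

theorem isVectorMul_coeffMul {N : ℕ} (c₀ : ℝ)
    (C : Fin N → Lp ℂ ⊤ (volume : Measure (LateralSpace d))) (c : Fin N → LateralSpace d → ℝ)
    (k : Fin N → ℝ) (hC : ∀ l, ∀ᵐ x, C l x = c l x) :
    IsVectorMul (coeffMul c₀ C k) fun x ↦ c₀ + ∑ l, c l x * k l := by
  intro p j
  have e : coeffMul c₀ C k p j = (c₀ : ℂ) • p j + ∑ l, (k l : ℂ) • (C l • p j : LateralL2 d) := by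
    simp only [coeffMul, add_apply, sum_apply, smul_apply, PiLp.add_apply,
      ContinuousLinearMap.id_apply]
    rw [WithLp.ofLp_sum, Finset.sum_apply]
    rfl
  rw [e]
  have hl : ∀ l, ∀ᵐ x, ((k l : ℂ) • (C l • p j : LateralL2 d) : LateralL2 d) x =
      (k l : ℂ) * (C l x * p j x) := by
    intro l
    filter_upwards [Lp.coeFn_smul (k l : ℂ) (C l • p j : LateralL2 d),
      Lp.coeFn_lpSMul (r := 2) (C l) (p j)] with x h1 h2
    rw [h1, Pi.smul_apply, h2, Pi.smul_apply', smul_eq_mul, smul_eq_mul]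
  filter_upwards [Lp.coeFn_add ((c₀ : ℂ) • p j) (∑ l, (k l : ℂ) • (C l • p j : LateralL2 d)),
    Lp.coeFn_smul (c₀ : ℂ) (p j), Lp.coeFn_finsetSum Finset.univ
      (fun l ↦ (k l : ℂ) • (C l • p j : LateralL2 d)), ae_all_iff.2 hC, ae_all_iff.2 hl]
    with x h1 h2 h3 h4 h5
  rw [h1, Pi.add_apply, h2, h3, Pi.smul_apply, smul_eq_mul, Finset.sum_apply]
  push_cast
  rw [add_mul, Finset.sum_mul]
  congr 1
  refine Finset.sum_congr rfl fun l _ ↦ ?_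
  rw [h5, h4]
  ring

/-- This is the splitting kC - k'C' = k(C - C') + (k - k')C'. The case k = k' gives the Lipschitz
bound in z, the case C = C' continuity in τ. -/
theorem norm_coeffMul_sub_le {N : ℕ} (c₀ : ℝ)
    (C C' : Fin N → Lp ℂ ⊤ (volume : Measure (LateralSpace d))) (k k' : Fin N → ℝ) :
    ‖coeffMul c₀ C k - coeffMul c₀ C' k'‖ ≤
      ∑ l, (|k l| * ‖C l - C' l‖ + |k l - k' l| * ‖C' l‖) := by
  have e : coeffMul c₀ C k - coeffMul c₀ C' k' =
      ∑ l, ((k l : ℂ) • vectorMul (C l - C' l) + ((k l - k' l : ℝ) : ℂ) • vectorMul (C' l)) := by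
    rw [coeffMul, coeffMul, add_sub_add_left_eq_sub, ← Finset.sum_sub_distrib]
    refine Finset.sum_congr rfl fun l _ ↦ ?_
    rw [vectorMul_sub]
    push_cast
    module
  rw [e]
  refine (norm_sum_le _ _).trans (Finset.sum_le_sum fun l _ ↦ (norm_add_le _ _).trans ?_)
  rw [norm_smul, norm_smul, Complex.norm_real, Complex.norm_real, Real.norm_eq_abs,
    Real.norm_eq_abs]
  gcongr <;> exact norm_vectorMul_le _

theorem norm_coeffMul_le {N : ℕ} (c₀ : ℝ)
    (C : Fin N → Lp ℂ ⊤ (volume : Measure (LateralSpace d))) (k : Fin N → ℝ) :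
    ‖coeffMul c₀ C k‖ ≤ |c₀| + ∑ l, |k l| * ‖C l‖ := by
  refine (norm_add_le _ _).trans (add_le_add ?_ ((norm_sum_le _ _).trans
    (Finset.sum_le_sum fun l _ ↦ ?_)))
  · rw [norm_smul, Complex.norm_real, Real.norm_eq_abs]
    exact mul_le_of_le_one_right (abs_nonneg _) ContinuousLinearMap.norm_id_le
  · rw [norm_smul, Complex.norm_real, Real.norm_eq_abs]
    gcongr
    exact norm_vectorMul_le _

end Coefficients

/-! ### Schwartz functions belong to the domain -/

section Domain

open FourierTransform TemperedDistribution

variable {d : ℕ}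

/-- The Leibniz rule for a Schwartz function times a distribution, dual to the one for two Schwartz
functions. -/
theorem lineDerivOp_smulLeftCLM_schwartz (φ : 𝓢(LateralSpace d, ℂ)) (T : 𝓢'(LateralSpace d, ℂ))
    (m : LateralSpace d) :
    ∂_{m} (smulLeftCLM ℂ φ T) = smulLeftCLM ℂ φ (∂_{m} T) + smulLeftCLM ℂ (∂_{m} φ : 𝓢(LateralSpace d, ℂ)) T := by
  ext ψ
  have hφ := φ.hasTemperateGrowth
  have hφ' := (∂_{m} φ).hasTemperateGrowth
  have key : SchwartzMap.smulLeftCLM ℂ φ (-∂_{m} ψ) =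
      -∂_{m} (SchwartzMap.smulLeftCLM ℂ φ ψ) + SchwartzMap.smulLeftCLM ℂ (∂_{m} φ : 𝓢(LateralSpace d, ℂ)) ψ := by
    ext x
    have h1 : ∂_{m} (SchwartzMap.smulLeftCLM ℂ φ ψ) x = φ x * ∂_{m} ψ x + ∂_{m} φ x * ψ x := by
      rw [SchwartzMap.lineDerivOp_apply_eq_fderiv, SchwartzMap.smulLeftCLM_apply hφ,
        SchwartzMap.lineDerivOp_apply_eq_fderiv, SchwartzMap.lineDerivOp_apply_eq_fderiv]
      have : (fun x ↦ φ x • ψ x) = fun x ↦ φ x * ψ x := rfl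
      rw [this, fderiv_fun_mul φ.differentiableAt ψ.differentiableAt]
      simp only [add_apply, smul_apply, smul_eq_mul]
      ring
    rw [SchwartzMap.smulLeftCLM_apply_apply hφ, add_apply, neg_apply,
      neg_apply, h1, SchwartzMap.smulLeftCLM_apply_apply hφ']
    simp only [smul_eq_mul]
    ring
  rw [lineDerivOp_apply_apply, smulLeftCLM_apply_apply, key, map_add]
  rfl

/-- By Leibniz, ∂_j(c_l ∂_jψ) = ∂_jψ ∂_j c_l + c_l ∂_j²ψ; both terms are in L², since c_l ∈ H¹ and
the derivatives of ψ are bounded. -/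
theorem schwartz_mem_divGrad_domain {N : ℕ} (c₀ : ℝ) (c : Fin N → LateralSpace d → ℝ)
    (k : Fin N → ℝ) (f : Fin N → LateralL2 d) (hf : ∀ l, ∀ᵐ x, f l x = c l x)
    (hf' : ∀ l, MemSobolev 1 2 (f l : 𝓢'(LateralSpace d, ℂ))) (ψ : 𝓢(LateralSpace d, ℂ)) :
    ψ.toLp 2 volume ∈ (divGrad fun x ↦ c₀ + ∑ l, c l x * k l).domain := by
  set e : Fin d → LateralSpace d := fun j ↦ EuclideanSpace.single j (1 : ℝ) with he
  set φ : Fin d → 𝓢(LateralSpace d, ℂ) := fun j ↦ ∂_{e j} ψ with hφ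
  have hder : ∀ l j, ∃ f' : LateralL2 d,
      ∂_{e j} (f l : 𝓢'(LateralSpace d, ℂ)) = (f' : 𝓢'(LateralSpace d, ℂ)) := by
    intro l j
    have := (hf' l).lineDerivOp (m := e j)
    rw [sub_self] at this
    exact memSobolev_zero_iff.1 this
  choose f' hf' using hder
  set p : Fin d → LateralL2 d := fun j ↦ (φ j).toLp 2 volume
  set q : Fin d → LateralL2 d := fun j ↦ (c₀ : ℂ) • p j +
    ∑ l, (k l : ℂ) • (((φ j).memLp ⊤ volume).toLp • f l : LateralL2 d) with hq
  -- The distributions represented by L² functions form a subspace, so membership can be checked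
  -- term by term.
  set R := (Lp.toTemperedDistributionCLM ℂ (volume : Measure (LateralSpace d)) 2).range
  have hmul : ∀ (η : 𝓢(LateralSpace d, ℂ)) (u : LateralL2 d),
      (((η.memLp ⊤ volume).toLp • u : LateralL2 d) : 𝓢'(LateralSpace d, ℂ)) =
        smulLeftCLM ℂ η (u : 𝓢'(LateralSpace d, ℂ)) := fun η u ↦
    Lp.toTemperedDistribution_smul_eq η.hasTemperateGrowth (η.memLp ⊤ volume) u
  have hqd : ∀ j, (q j : 𝓢'(LateralSpace d, ℂ)) = (c₀ : ℂ) • (φ j : 𝓢'(LateralSpace d, ℂ)) +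
      ∑ l, (k l : ℂ) • smulLeftCLM ℂ (φ j) (f l : 𝓢'(LateralSpace d, ℂ)) := by
    intro j
    have := map_add (Lp.toTemperedDistributionCLM ℂ volume 2) ((c₀ : ℂ) • p j)
      (∑ l, (k l : ℂ) • (((φ j).memLp ⊤ volume).toLp • f l : LateralL2 d))
    rw [map_sum, map_smul] at this
    simp only [map_smul, Lp.toTemperedDistributionCLM_apply] at this
    rw [hq]
    simp only
    rw [this]
    congr 2
    · simp [p]
    · ext1 l
      rw [hmul]
  have hR : ∀ j, ∂_{e j} (q j : 𝓢'(LateralSpace d, ℂ)) ∈ R := by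
    intro j
    rw [hqd, LineDeriv.lineDerivOp_add, LineDeriv.lineDerivOp_smul, LineDeriv.lineDerivOp_sum]
    refine R.add_mem (R.smul_mem _ ?_) (R.sum_mem fun l _ ↦ ?_)
    · rw [lineDerivOp_toTemperedDistributionCLM_eq]
      exact ⟨(∂_{e j} (φ j) : 𝓢(LateralSpace d, ℂ)).toLp 2 volume, by simp⟩
    · rw [LineDeriv.lineDerivOp_smul, lineDerivOp_smulLeftCLM_schwartz, hf', ← hmul, ← hmul]
      exact R.smul_mem _ (R.add_mem ⟨_, rfl⟩ ⟨_, rfl⟩)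
  obtain ⟨w, hw⟩ : ∑ j, ∂_{e j} (q j : 𝓢'(LateralSpace d, ℂ)) ∈ R := R.sum_mem fun j _ ↦ hR j
  rw [LinearPMap.mem_domain_iff]
  refine ⟨w, ?_⟩
  rw [divGrad_graph]
  refine ⟨?_, p, q, fun j ↦ ?_, fun j ↦ ?_, hw⟩
  · simpa using SchwartzMap.memSobolev (s := 2) (p := 2) ψ
  · simp [p, φ, lineDerivOp_toTemperedDistributionCLM_eq, he]
  · have hl : ∀ l, ∀ᵐ x, ((k l : ℂ) • (((φ j).memLp ⊤ volume).toLp • f l : LateralL2 d) :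
        LateralL2 d) x = (k l : ℂ) * (φ j x * f l x) := by
      intro l
      filter_upwards [Lp.coeFn_smul (k l : ℂ) (((φ j).memLp ⊤ volume).toLp • f l : LateralL2 d),
        Lp.coeFn_lpSMul (r := 2) ((φ j).memLp ⊤ volume).toLp (f l),
        ((φ j).memLp ⊤ volume).coeFn_toLp] with x h1 h2 h3
      rw [h1, Pi.smul_apply, h2, Pi.smul_apply', h3, smul_eq_mul, smul_eq_mul]
    filter_upwards [Lp.coeFn_add ((c₀ : ℂ) • p j)
        (∑ l, (k l : ℂ) • (((φ j).memLp ⊤ volume).toLp • f l : LateralL2 d)),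
      Lp.coeFn_smul (c₀ : ℂ) (p j), Lp.coeFn_finsetSum Finset.univ
        (fun l ↦ (k l : ℂ) • (((φ j).memLp ⊤ volume).toLp • f l : LateralL2 d)),
      ae_all_iff.2 hf, ae_all_iff.2 hl, (φ j).coeFn_toLp 2 volume] with x h1 h2 h3 h4 h5 h6
    rw [hq]
    simp only
    rw [h1, Pi.add_apply, h2, h3, Pi.smul_apply, smul_eq_mul, Finset.sum_apply]
    push_cast
    rw [add_mul, Finset.sum_mul]
    congr 1
    refine Finset.sum_congr rfl fun l _ ↦ ?_
    rw [h5, h4, h6]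
    ring

end Domain

/-! ### Evolution systems of divergence form operators -/

section Evolution

open FourierTransform TemperedDistribution

variable {d : ℕ}

/-- The graph of the gradient on `H¹(ℝ^d)`. -/
def gradGraph (d : ℕ) : Submodule ℂ (LateralL2 d × LateralVector d) where
  carrier := {y | ∀ j, ∂_{EuclideanSpace.single j (1 : ℝ)} (y.1 : 𝓢'(LateralSpace d, ℂ)) =
    (y.2 j : 𝓢'(LateralSpace d, ℂ))}
  add_mem' := by
    intro y y' hy hy' j
    rw [Prod.fst_add, Prod.snd_add, PiLp.add_apply, LateralL2.coe_add, LateralL2.coe_add,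
      LineDeriv.lineDerivOp_add, hy j, hy' j]
  zero_mem' := by
    intro j
    rw [Prod.fst_zero, Prod.snd_zero, PiLp.zero_apply, LateralL2.coe_zero,
      LineDeriv.lineDerivOp_zero]
  smul_mem' := by
    intro k y hy j
    rw [Prod.smul_fst, Prod.smul_snd, PiLp.smul_apply, LateralL2.coe_smul, LateralL2.coe_smul,
      LineDeriv.lineDerivOp_smul, hy j]

theorem gradGraph_single_valued {v : LateralL2 d} {p p' : LateralVector d}
    (hp : (v, p) ∈ gradGraph d) (hp' : (v, p') ∈ gradGraph d) : p = p' := by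
  ext1 j
  have h : (p j : 𝓢'(LateralSpace d, ℂ)) = (p' j : 𝓢'(LateralSpace d, ℂ)) :=
    (hp j).symm.trans (hp' j)
  have hker := Lp.ker_toTemperedDistributionCLM_eq_bot (E := LateralSpace d) (F := ℂ) (p := 2)
    (μ := volume)
  exact LinearMap.ker_eq_bot.1 hker h

/-- Integration by parts passes from the operator to its quadratic form, for test functions that are
merely in H¹. -/
theorem exists_grad_of_mem_divGradGraph {α : LateralSpace d → ℝ}
    {A : LateralVector d →L[ℂ] LateralVector d} (hA : IsVectorMul A α) {v w : LateralL2 d}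
    (h : (v, w) ∈ divGradGraph α) :
    ∃ p, (v, p) ∈ gradGraph d ∧ ∀ y ∈ gradGraph d, inner ℂ y.1 w = -inner ℂ y.2 (A p) := by
  obtain ⟨-, p, q, hp, hq, hw⟩ := h
  refine ⟨WithLp.toLp 2 p, hp, fun y hy ↦ ?_⟩
  rw [LateralL2.inner_eq_neg_sum_inner hy hw, PiLp.inner_apply]
  congr 1
  refine Finset.sum_congr rfl fun j _ ↦ ?_
  congr 1
  apply Lp.ext
  filter_upwards [hq j, hA (WithLp.toLp 2 p) j] with x h1 h2
  rw [h1, h2]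

namespace IsEvolutionSystem

variable {Z : ℝ} {α : ℝ → LateralSpace d → ℝ} {U : ℝ → ℝ → LateralL2 d →L[ℂ] LateralL2 d}
  {a : ℝ → LateralVector d →L[ℂ] LateralVector d}

theorem exists_isFormSolution
    (hU : IsEvolutionSystem Z (fun z ↦ Complex.I • divGrad (α z)) U)
    (ha : ∀ z ∈ Icc 0 Z, IsVectorMul (a z) (α z)) {s : ℝ} (hs : s ∈ Icc 0 Z) {v : LateralL2 d}
    (hv : v ∈ commonDomain Z fun z ↦ Complex.I • divGrad (α z)) :
    ∃ w p, IsFormSolution (gradGraph d) a s Z (fun ζ ↦ U ζ s v) w p := by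
  have hsub : ∀ ζ ∈ Icc s Z, ζ ∈ Icc 0 Z := fun ζ hζ ↦ ⟨hs.1.trans hζ.1, hζ.2⟩
  have hw : ∀ ζ ∈ Icc s Z, ∃ w, (U ζ s v, w) ∈ divGradGraph (α ζ) ∧
      HasDerivWithinAt (fun ζ ↦ U ζ s v) (Complex.I • w) (Icc s Z) ζ := by
    intro ζ hζ
    have hd := hU.hasDerivWithinAt_left ζ (hsub ζ hζ) s ⟨hs.1, hζ.1⟩ v hv
    have hmem := hU.mapsTo ζ (hsub ζ hζ) s ⟨hs.1, hζ.1⟩ v hv ζ (hsub ζ hζ)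
    refine ⟨divGrad (α ζ) ⟨U ζ s v, hmem⟩, ?_, hd⟩
    rw [← divGrad_graph]
    exact (divGrad (α ζ)).mem_graph ⟨U ζ s v, hmem⟩
  choose! w hw hd using hw
  have hp : ∀ ζ ∈ Icc s Z, ∃ p, (U ζ s v, p) ∈ gradGraph d ∧
      ∀ y ∈ gradGraph d, inner ℂ y.1 (w ζ) = -inner ℂ y.2 (a ζ p) := fun ζ hζ ↦
    exists_grad_of_mem_divGradGraph (ha ζ (hsub ζ hζ)) (hw ζ hζ)
  choose! p hp hp' using hp
  refine ⟨w, p, hd, ?_, hp, hp'⟩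
  -- For s = Z the interval is a point, where derivatives are not unique; otherwise continuity of
  -- `w` comes from that of the derivative i w.
  rcases hs.2.eq_or_lt with rfl | hlt
  · rw [Icc_self]
    exact continuousOn_singleton _ _
  · have hI : ContinuousOn (fun ζ ↦ Complex.I • w ζ) (Icc s Z) := by
      refine ((hU.contDiffOn_left s hs v hv).continuousOn_derivWithin (uniqueDiffOn_Icc hlt)
        le_rfl).congr fun ζ hζ ↦ ?_
      exact ((hd ζ hζ).derivWithin (uniqueDiffOn_Icc hlt ζ hζ)).symm
    refine (hI.const_smul (-Complex.I)).congr fun ζ _ ↦ ?_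
    simp [smul_smul]

theorem norm_apply_le (hU : IsEvolutionSystem Z (fun z ↦ Complex.I • divGrad (α z)) U)
    (ha : ∀ z ∈ Icc 0 Z, IsVectorMul (a z) (α z))
    (hdense : Dense (commonDomain Z fun z ↦ Complex.I • divGrad (α z)))
    {z₁ z₂ : ℝ} (h₂ : 0 ≤ z₂) (h₁₂ : z₂ ≤ z₁) (h₁ : z₁ ≤ Z) (v : LateralL2 d) :
    ‖U z₁ z₂ v‖ ≤ ‖v‖ := by
  have hz₂ : z₂ ∈ Icc 0 Z := ⟨h₂, h₁₂.trans h₁⟩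
  refine hdense.induction (P := fun v ↦ ‖U z₁ z₂ v‖ ≤ ‖v‖) (fun v hv ↦ ?_)
    (isClosed_le (by fun_prop) (by fun_prop)) v
  obtain ⟨w, p, hs⟩ := hU.exists_isFormSolution ha hz₂ hv
  have := hs.norm_eq (fun ζ hζ ↦ (ha ζ ⟨h₂.trans hζ.1, hζ.2⟩).isSymmetric) ⟨h₁₂, h₁⟩
  rw [hU.refl z₂ hz₂] at this
  exact this.le

/-- Two evolution systems, whose coefficients are close to each other, are close to each other on
sufficiently regular initial values. -/
theorem norm_sub_sq_le {α' : ℝ → LateralSpace d → ℝ} {U' : ℝ → ℝ → LateralL2 d →L[ℂ] LateralL2 d}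
    {a' : ℝ → LateralVector d →L[ℂ] LateralVector d}
    (hU : IsEvolutionSystem Z (fun z ↦ Complex.I • divGrad (α z)) U)
    (hU' : IsEvolutionSystem Z (fun z ↦ Complex.I • divGrad (α' z)) U')
    (ha : ∀ z ∈ Icc 0 Z, IsVectorMul (a z) (α z)) (ha' : ∀ z ∈ Icc 0 Z, IsVectorMul (a' z) (α' z))
    {c₀ K M δ : ℝ} (hc₀ : 0 < c₀) (hK : 0 ≤ K) (hM : 0 ≤ M)
    (hα : ∀ z ∈ Icc 0 Z, ∀ᵐ x, c₀ ≤ α z x) (hα' : ∀ z ∈ Icc 0 Z, ∀ᵐ x, c₀ ≤ α' z x)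
    (hlip : ∀ z ∈ Icc 0 Z, ∀ z' ∈ Icc 0 Z, ‖a z' - a z‖ ≤ K * |z' - z|)
    (hlip' : ∀ z ∈ Icc 0 Z, ∀ z' ∈ Icc 0 Z, ‖a' z' - a' z‖ ≤ K * |z' - z|)
    (hbd : ∀ z ∈ Icc 0 Z, ‖a z‖ ≤ M) (hbd' : ∀ z ∈ Icc 0 Z, ‖a' z‖ ≤ M)
    (hδ : ∀ z ∈ Icc 0 Z, ‖a z - a' z‖ ≤ δ) {v : LateralL2 d} {p₀ : LateralVector d}
    (hp₀ : (v, p₀) ∈ gradGraph d) (hv : v ∈ commonDomain Z fun z ↦ Complex.I • divGrad (α z))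
    (hv' : v ∈ commonDomain Z fun z ↦ Complex.I • divGrad (α' z))
    {z₁ z₂ : ℝ} (h₂ : 0 ≤ z₂) (h₁₂ : z₂ ≤ z₁) (h₁ : z₁ ≤ Z) :
    ‖U z₁ z₂ v - U' z₁ z₂ v‖ ^ 2 ≤
      2 * (M * ‖p₀‖ ^ 2 * Real.exp (K / c₀ * Z) / c₀ * δ) * Z := by
  have hz₂ : z₂ ∈ Icc 0 Z := ⟨h₂, h₁₂.trans h₁⟩
  have hZ : 0 ≤ Z := hz₂.1.trans hz₂.2
  have hsub : ∀ ζ ∈ Icc z₂ Z, ζ ∈ Icc 0 Z := fun ζ hζ ↦ ⟨h₂.trans hζ.1, hζ.2⟩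
  obtain ⟨w, p, hs⟩ := hU.exists_isFormSolution ha hz₂ hv
  obtain ⟨w', p', hs'⟩ := hU'.exists_isFormSolution ha' hz₂ hv'
  -- A bound for ‖∇u‖² common to both systems and uniform in `z₁` and `z₂`; it depends on the
  -- initial value only through its gradient `p₀`.
  set B : ℝ := M * ‖p₀‖ ^ 2 * Real.exp (K / c₀ * Z) / c₀ with hB
  have hB0 : 0 ≤ B := by positivity
  have hδ0 : 0 ≤ δ := (norm_nonneg _).trans (hδ z₂ hz₂)
  have aux : ∀ (α : ℝ → LateralSpace d → ℝ) (a : ℝ → LateralVector d →L[ℂ] LateralVector d)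
      (U : ℝ → ℝ → LateralL2 d →L[ℂ] LateralL2 d) (w : ℝ → LateralL2 d) (p : ℝ → LateralVector d),
      (∀ z ∈ Icc 0 Z, IsVectorMul (a z) (α z)) → (∀ z ∈ Icc 0 Z, ∀ᵐ x, c₀ ≤ α z x) →
      (∀ z ∈ Icc 0 Z, ∀ z' ∈ Icc 0 Z, ‖a z' - a z‖ ≤ K * |z' - z|) →
      (∀ z ∈ Icc 0 Z, ‖a z‖ ≤ M) → U z₂ z₂ = ContinuousLinearMap.id ℂ _ →
      IsFormSolution (gradGraph d) a z₂ Z (fun ζ ↦ U ζ z₂ v) w p →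
      ∀ ζ ∈ Icc z₂ Z, ‖p ζ‖ ≤ √B := by
    intro α a U w p ha hα hlip hbd hrefl hs ζ hζ
    have key := hs.grad_bound (fun ζ hζ ↦ (ha ζ (hsub ζ hζ)).isSymmetric) hc₀ hK
      (fun ζ hζ q ↦ (ha ζ (hsub ζ hζ)).mul_norm_sq_le (hα ζ (hsub ζ hζ)) q)
      (fun ζ hζ ζ' hζ' ↦ hlip ζ (hsub ζ hζ) ζ' (hsub ζ' hζ')) hζ
    have hg := hs.grad z₂ ⟨le_rfl, hz₂.2⟩
    simp only [hrefl, ContinuousLinearMap.id_apply] at hg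
    rw [gradGraph_single_valued hg hp₀] at key
    refine Real.le_sqrt_of_sq_le ?_
    rw [hB, le_div_iff₀ hc₀, mul_comm]
    refine key.trans ?_
    have h3 : K / c₀ * (ζ - z₂) ≤ K / c₀ * Z :=
      mul_le_mul_of_nonneg_left (by linarith [hζ.2]) (by positivity)
    gcongr
    exact hbd z₂ hz₂
  have key := hs.norm_sub_sq_le hs' (fun ζ hζ ↦ (ha ζ (hsub ζ hζ)).isSymmetric)
    (fun ζ hζ ↦ (ha' ζ (hsub ζ hζ)).isSymmetric)
    (by simp only [hU.refl z₂ hz₂, hU'.refl z₂ hz₂])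
    (aux α a U w p ha hα hlip hbd (hU.refl z₂ hz₂) hs)
    (aux α' a' U' w' p' ha' hα' hlip' hbd' (hU'.refl z₂ hz₂) hs')
    (fun ζ hζ ↦ hδ ζ (hsub ζ hζ)) (ζ := z₁) ⟨h₁₂, h₁⟩
  rw [Real.sq_sqrt hB0] at key
  refine key.trans ?_
  gcongr
  linarith

end IsEvolutionSystem

theorem exists_mem_gradGraph_schwartz (ψ : 𝓢(LateralSpace d, ℂ)) :
    ∃ p, (ψ.toLp 2 volume, p) ∈ gradGraph d := by
  refine ⟨WithLp.toLp 2 fun j ↦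
    (∂_{EuclideanSpace.single j (1 : ℝ)} ψ : 𝓢(LateralSpace d, ℂ)).toLp 2 volume, fun j ↦ ?_⟩
  simp [lineDerivOp_toTemperedDistributionCLM_eq]

/-- This provides initial values admissible for all τ at once, as needed to compare the systems at τ
and τ₀. -/
theorem CoeffAssumption.schwartz_mem_commonDomain {N : ℕ} {m c₀ : ℝ}
    {c : Fin N → ℝ → LateralSpace d → ℝ} {h : Fin N → ℝ → ℝ} (hA : CoeffAssumption m c₀ c h)
    (Z τ : ℝ) (ψ : 𝓢(LateralSpace d, ℂ)) :
    ψ.toLp 2 volume ∈ commonDomain Z fun z ↦ Complex.I • paraxialOp c₀ c h τ z := by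
  intro z hz
  obtain ⟨r, hr, hreg⟩ := hA.regularity
  have hf : ∀ l, ∃ f : LateralL2 d, (∀ᵐ x, f x = (c l z x : ℂ)) ∧
      MemSobolev 1 2 (f : 𝓢'(LateralSpace d, ℂ)) := by
    intro l
    obtain ⟨g, -, hg⟩ := hreg l
    obtain ⟨f, hf, hfg⟩ := hg z hz.1
    have : MemSobolev (r + 1) 2 (f : 𝓢'(LateralSpace d, ℂ)) := ⟨g z, hfg⟩
    exact ⟨f, hf, this.mono (by linarith [hr.1])⟩
  choose f hf hf' using hf
  exact schwartz_mem_divGrad_domain c₀ (fun l ↦ c l z) (fun l ↦ h l τ) f hf hf' ψ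

theorem CoeffAssumption.dense_commonDomain {N : ℕ} {m c₀ : ℝ}
    {c : Fin N → ℝ → LateralSpace d → ℝ} {h : Fin N → ℝ → ℝ} (hA : CoeffAssumption m c₀ c h)
    (Z τ : ℝ) : Dense (commonDomain Z fun z ↦ Complex.I • paraxialOp c₀ c h τ z) := by
  have hd : DenseRange (SchwartzMap.toLpCLM ℂ (E := LateralSpace d) ℂ 2 volume) :=
    SchwartzMap.denseRange_toLpCLM ENNReal.ofNat_ne_top
  refine Dense.mono ?_ hd
  rintro _ ⟨ψ, rfl⟩
  exact hA.schwartz_mem_commonDomain Z τ ψ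

/-- The coefficient is, as a multiplication operator, Lipschitz continuous in `z` and continuous in
`τ`, locally uniformly. -/
theorem CoeffAssumption.exists_vectorMul {N : ℕ} (hd : d ≤ 2) {m c₀ : ℝ}
    {c : Fin N → ℝ → LateralSpace d → ℝ} {h : Fin N → ℝ → ℝ} (hA : CoeffAssumption m c₀ c h)
    (Z τ₀ : ℝ) :
    ∃ (a : ℝ → ℝ → LateralVector d →L[ℂ] LateralVector d) (K M : ℝ) (δ : ℝ → ℝ),
      0 ≤ K ∧ 0 ≤ M ∧ Tendsto δ (𝓝 τ₀) (𝓝 0) ∧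
      (∀ τ, ∀ z ∈ Icc 0 Z, IsVectorMul (a τ z) (paraxialCoeff c₀ c h z τ)) ∧
      (∀ᶠ τ in 𝓝 τ₀, (∀ z ∈ Icc 0 Z, ∀ z' ∈ Icc 0 Z, ‖a τ z' - a τ z‖ ≤ K * |z' - z|) ∧
        ∀ z ∈ Icc 0 Z, ‖a τ z‖ ≤ M) ∧
      ∀ τ, ∀ z ∈ Icc 0 Z, ‖a τ z - a τ₀ z‖ ≤ δ τ := by
  obtain ⟨r, hr, hreg⟩ := hA.regularity
  -- The dimension restriction enters here: r > 0 puts H^{r+1} above the embedding threshold d/2 ≤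
  -- 1.
  have hs : (d : ℝ) < 2 * (r + 1) := by
    have : (d : ℝ) ≤ 2 := by exact_mod_cast hd
    linarith [hr.1]
  choose C K hK hC hlip using fun l ↦ (hreg l).exists_Lp_top hs Z
  have hBex : ∀ l, ∃ B, 0 ≤ B ∧ ∀ z ∈ Icc 0 Z, ‖C l z‖ ≤ B := by
    intro l
    have hcont : ContinuousOn (C l) (Icc 0 Z) := by
      refine LipschitzOnWith.continuousOn (K := ⟨K l, hK l⟩)
        (LipschitzOnWith.of_dist_le_mul fun z hz z' hz' ↦ ?_)
      rw [dist_eq_norm, Real.dist_eq]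
      exact hlip l z' hz' z hz
    obtain ⟨B, hB⟩ := isCompact_Icc.exists_bound_of_continuousOn hcont
    exact ⟨max B 0, le_max_right _ _, fun z hz ↦ (hB z hz).trans (le_max_left _ _)⟩
  choose B hB0 hB using hBex
  have hcont : ∀ l, Continuous (h l) := fun l ↦ (hA.smooth_symbol l).continuous
  have hH : ∀ᶠ τ in 𝓝 τ₀, ∀ l, |h l τ| ≤ |h l τ₀| + 1 := by
    refine eventually_all.2 fun l ↦ ?_
    filter_upwards [((hcont l).abs.tendsto τ₀).eventually (gt_mem_nhds (lt_add_one _))] with τ hτ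
    exact hτ.le
  refine ⟨fun τ z ↦ coeffMul c₀ (fun l ↦ C l z) fun l ↦ h l τ, ∑ l, (|h l τ₀| + 1) * K l,
    |c₀| + ∑ l, (|h l τ₀| + 1) * B l, fun τ ↦ ∑ l, |h l τ - h l τ₀| * B l, ?_, ?_, ?_,
    fun τ z hz ↦ ?_, ?_, fun τ z hz ↦ ?_⟩
  · exact Finset.sum_nonneg fun l _ ↦ mul_nonneg (by positivity) (hK l)
  · exact add_nonneg (abs_nonneg _)
      (Finset.sum_nonneg fun l _ ↦ mul_nonneg (by positivity) (hB0 l))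
  · have : Continuous fun τ ↦ ∑ l, |h l τ - h l τ₀| * B l := by fun_prop
    simpa using this.tendsto τ₀
  · exact isVectorMul_coeffMul c₀ (fun l ↦ C l z) (fun l ↦ c l z) (fun l ↦ h l τ)
      fun l ↦ hC l z hz
  · filter_upwards [hH] with τ hτ
    refine ⟨fun z hz z' hz' ↦ (norm_coeffMul_sub_le _ _ _ _ _).trans ?_,
      fun z hz ↦ (norm_coeffMul_le _ _ _).trans ?_⟩
    · rw [Finset.sum_mul]
      refine Finset.sum_le_sum fun l _ ↦ ?_
      rw [sub_self, abs_zero, zero_mul, add_zero, mul_assoc]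
      exact mul_le_mul (hτ l) (hlip l z hz z' hz') (norm_nonneg _) (by positivity)
    · gcongr with l _
      exacts [hτ l, hB l z hz]
  · refine (norm_coeffMul_sub_le _ _ _ _ _).trans (Finset.sum_le_sum fun l _ ↦ ?_)
    rw [sub_self, norm_zero, mul_zero, zero_add]
    gcongr
    exact hB l z hz

end Evolution

end

/-! ### Joint strong continuity by density -/

theorem mainTheorem4 {d N : ℕ} (hd : d ≤ 2) (m c₀ : ℝ) (c : Fin N → ℝ → LateralSpace d → ℝ)
    (h : Fin N → ℝ → ℝ) (hA : CoeffAssumption m c₀ c h) (Z : ℝ) (hZ : 0 < Z)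
    (U : ℝ → ℝ → ℝ → LateralL2 d →L[ℂ] LateralL2 d)
    (hU : ∀ τ, IsEvolutionSystem Z (fun z ↦ Complex.I • paraxialOp c₀ c h τ z) (U τ)) :
    ∀ v : LateralL2 d,
      ContinuousOn (fun p : ℝ × ℝ × ℝ ↦ U p.1 p.2.1 p.2.2 v)
        {p | Z ≥ p.2.1 ∧ p.2.1 ≥ p.2.2 ∧ p.2.2 ≥ 0} := by
  rintro v ⟨τ₀, ζ₁, ζ₂⟩ hζ
  obtain ⟨a, K, M, δ, hK, hM, hδ, hmul, hev, hclose⟩ := hA.exists_vectorMul hd Z τ₀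
  have hcontr : ∀ τ z₁ z₂, Z ≥ z₁ → z₁ ≥ z₂ → z₂ ≥ 0 → ∀ v, ‖U τ z₁ z₂ v‖ ≤ ‖v‖ :=
    fun τ z₁ z₂ h1 h2 h3 v ↦ (hU τ).norm_apply_le (hmul τ) (hA.dense_commonDomain Z τ) h3 h2 h1 v
  rw [ContinuousWithinAt, Metric.tendsto_nhds]
  intro ε hε
  have hdense : DenseRange (SchwartzMap.toLpCLM ℂ (E := LateralSpace d) ℂ 2 volume) :=
    SchwartzMap.denseRange_toLpCLM ENNReal.ofNat_ne_top
  obtain ⟨ψ, hψ⟩ := hdense.exists_dist_lt v (ε := ε / 4) (by positivity)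
  set u : LateralL2 d := ψ.toLp 2 volume with hu
  replace hψ : ‖v - u‖ < ε / 4 := by rwa [dist_eq_norm] at hψ
  obtain ⟨p₀, hp₀⟩ := exists_mem_gradGraph_schwartz ψ
  have hlim : Tendsto (fun τ ↦ 2 * (M * ‖p₀‖ ^ 2 * Real.exp (K / c₀ * Z) / c₀ * δ τ) * Z) (𝓝 τ₀)
      (𝓝 0) := by
    simpa using ((hδ.const_mul (M * ‖p₀‖ ^ 2 * Real.exp (K / c₀ * Z) / c₀)).const_mul 2).mul_const Z
  -- The uniformity in `z₁` and `z₂` allows all three parameters to move at once.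
  have hτ : ∀ᶠ τ in 𝓝 τ₀, ∀ z₁ z₂, Z ≥ z₁ → z₁ ≥ z₂ → z₂ ≥ 0 →
      ‖U τ z₁ z₂ u - U τ₀ z₁ z₂ u‖ < ε / 4 := by
    filter_upwards [hev, hlim.eventually (gt_mem_nhds (show 0 < (ε / 4) ^ 2 by positivity))]
      with τ h1 h2 z₁ z₂ hz₁ hz₁₂ hz₂
    have := (hU τ).norm_sub_sq_le (hU τ₀) (hmul τ) (hmul τ₀) hA.const_pos hK hM
      (fun z hz ↦ hA.elliptic z hz.1 τ) (fun z hz ↦ hA.elliptic z hz.1 τ₀) h1.1 hev.self_of_nhds.1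
      h1.2 hev.self_of_nhds.2 (hclose τ) hp₀ (hA.schwartz_mem_commonDomain Z τ ψ)
      (hA.schwartz_mem_commonDomain Z τ₀ ψ) hz₂ hz₁₂ hz₁
    exact lt_of_pow_lt_pow_left₀ 2 (by positivity) (this.trans_lt h2)
  have hfst : Tendsto (fun p : ℝ × ℝ × ℝ ↦ p.1)
      (𝓝[{p | Z ≥ p.2.1 ∧ p.2.1 ≥ p.2.2 ∧ p.2.2 ≥ 0}] (τ₀, ζ₁, ζ₂)) (𝓝 τ₀) :=
    (continuous_fst.tendsto (τ₀, ζ₁, ζ₂)).mono_left nhdsWithin_le_nhds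
  have hsnd : Tendsto (fun p : ℝ × ℝ × ℝ ↦ p.2)
      (𝓝[{p | Z ≥ p.2.1 ∧ p.2.1 ≥ p.2.2 ∧ p.2.2 ≥ 0}] (τ₀, ζ₁, ζ₂))
      (𝓝[{p | Z ≥ p.1 ∧ p.1 ≥ p.2 ∧ p.2 ≥ 0}] (ζ₁, ζ₂)) :=
    tendsto_nhdsWithin_iff.2 ⟨(continuous_snd.tendsto (τ₀, ζ₁, ζ₂)).mono_left nhdsWithin_le_nhds,
      eventually_mem_nhdsWithin⟩
  have hstrong := ((hU τ₀).stronglyContinuous u (ζ₁, ζ₂) hζ).tendsto.comp hsnd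
  filter_upwards [hfst.eventually hτ, Metric.tendsto_nhds.1 hstrong (ε / 4) (by positivity),
    self_mem_nhdsWithin] with p h1 h2 hp
  obtain ⟨hp1, hp2, hp3⟩ := hp
  obtain ⟨hq1, hq2, hq3⟩ := hζ
  have e1 := h1 p.2.1 p.2.2 hp1 hp2 hp3
  rw [dist_eq_norm] at h2 ⊢
  have e3 := (hcontr p.1 p.2.1 p.2.2 hp1 hp2 hp3 (v - u)).trans_lt hψ
  have e4 := (hcontr τ₀ ζ₁ ζ₂ hq1 hq2 hq3 (v - u)).trans_lt hψ
  -- Four errors, each below ε/4: approximation of `v` at both ends, the change of τ at fixed (z₁,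
  -- z₂), and the change of (z₁, z₂) at τ₀.
  have e5 : U p.1 p.2.1 p.2.2 v - U τ₀ ζ₁ ζ₂ v = U p.1 p.2.1 p.2.2 (v - u)
      + (U p.1 p.2.1 p.2.2 u - U τ₀ p.2.1 p.2.2 u) + (U τ₀ p.2.1 p.2.2 u - U τ₀ ζ₁ ζ₂ u)
      - U τ₀ ζ₁ ζ₂ (v - u) := by
    rw [map_sub, map_sub]
    abel
  change ‖U p.1 p.2.1 p.2.2 v - U τ₀ ζ₁ ζ₂ v‖ < ε
  change ‖U τ₀ p.2.1 p.2.2 u - U τ₀ ζ₁ ζ₂ u‖ < ε / 4 at h2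
  rw [e5]
  calc _ ≤ ‖U p.1 p.2.1 p.2.2 (v - u)‖ + ‖U p.1 p.2.1 p.2.2 u - U τ₀ p.2.1 p.2.2 u‖
        + ‖U τ₀ p.2.1 p.2.2 u - U τ₀ ζ₁ ζ₂ u‖ + ‖U τ₀ ζ₁ ζ₂ (v - u)‖ :=
      (norm_sub_le _ _).trans (add_le_add (norm_add₃_le) le_rfl)
    _ < ε := by linarith
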